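/- Let $\Gamma$ be a weighted digraph without loops on a finite vertex set of size $n$, with strictly positive arc weights $w_{ij}$ ($w_{ij}=0$ iff there is no arc from $i$ to $j$), and let $L=(\ell_{ij})$ be its Laplacian matrix, $\ell_{ij}=-w_{ij}$ for $j\neq i$ and $\ell_{ii}=\sum_{m\neq i}w_{im}$. An in-forest of $\Gamma$ is a spanning subgraph each of whose weak components is a converging tree, that is, has one vertex (the root) of outdegree $0$ while its other vertices have outdegree $1$. The weight of a subgraph is the product of the weights of its arcs ($1$ if it has none). Let $d$ be the minimum possible number of trees in an in-forest of $\Gamma$, and for $k=0,1,\dots$ let $Q_k$ be the $n\times n$ matrix whose $(i,j)$ entry is the total weight of the in-forests of $\Gamma$ with exactly $k$ arcs in which $i$ belongs to a tree with root $j$. Then, with the convention $\lambda^0\equiv 1$, $$\operatorname{adj}(\lambda I+L)=\sum_{k=0}^{n-d}Q_k\lambda^{n-k-1},$$ both for every real $\lambda$ and as an identity of polynomials in the indeterminate $\lambda$. Hence, for $0\le k\le n-1$, $Q_k$ is the matrix coefficient of $\lambda^{n-k-1}$ in the adjugate of the characteristic matrix $\lambda I-(-L)$ of $-L$. Moreover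 the $Q_k$ are Faddeev's matrices for $-L$: if $B_0=I$ and $B_{k+1}=AB_k-\frac{\operatorname{tr}(AB_k)}{k+1}I$ with $A=-L$, then $Q_k=B_k$ for all $k\ge 0$. -/

import Mathlib

/-- A weighted digraph without loops on the vertex set `V`, given by its matrix of arc weights.
All arcs have strictly positive weight, and `weight i j = 0` iff there is no arc from `i` to `j`. -/
structure WeightedDigraph (V : Type*) where
  weight : V → V → ℝ
  weight_nonneg : ∀ i j, 0 ≤ weight i j
  weight_self : ∀ i, weight i i = 0

namespace ArcSet

variable {V : Type*}

/-! A digraph with vertex set `V` is given here by its finite set `F` of arcs;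
`(i, j) ∈ F` is an arc from `i` to `j`. -/

/-- The outdegree of a vertex: the number of arcs that come from it. -/
def outdegree [DecidableEq V] (F : Finset (V × V)) (v : V) : ℕ :=
  (F.filter fun a => a.1 = v).card

/-- The underlying undirected graph. Its connected components are the weak components of the
digraph. -/
def underlying (F : Finset (V × V)) : SimpleGraph V :=
  SimpleGraph.fromRel fun i j => (i, j) ∈ F

/-- The weak component `C` of the digraph is a converging tree with root `r`: `r` is a vertex
of `C` of outdegree zero and the remaining vertices of `C` have outdegree one. (All arcs from a
vertex of `C` stay in `C`, and `C` is weakly connected by definition.) -/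
def IsConvergingTree [DecidableEq V] (F : Finset (V × V))
    (C : (underlying F).ConnectedComponent) (r : V) : Prop :=
  r ∈ C.supp ∧ outdegree F r = 0 ∧ ∀ v ∈ C.supp, v ≠ r → outdegree F v = 1

/-- A converging forest: every weak component is a converging tree. -/
def IsConvergingForest [DecidableEq V] (F : Finset (V × V)) : Prop :=
  ∀ C : (underlying F).ConnectedComponent, ∃ r, IsConvergingTree F C r

/-- The number of weak components (the number of trees if the digraph is a converging forest). -/
noncomputable def numTrees (F : Finset (V × V)) : ℕ :=
  Nat.card (underlying F).ConnectedComponent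

/-- The weak component of `i` is a tree converging to `j`. -/
def ConvergesTo [DecidableEq V] (F : Finset (V × V)) (i j : V) : Prop :=
  IsConvergingTree F ((underlying F).connectedComponentMk i) j

end ArcSet

namespace WeightedDigraph

variable {V : Type*} [Fintype V] [DecidableEq V]

open Classical in
/-- The set of arcs of `Γ`. -/
noncomputable def arcs (Γ : WeightedDigraph V) : Finset (V × V) :=
  Finset.univ.filter fun a => 0 < Γ.weight a.1 a.2

/-- The weight of a subgraph: the product of the weights of its arcs (`1` if there are none). -/
noncomputable def subgraphWeight (Γ : WeightedDigraph V) (F : Finset (V × V)) : ℝ :=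
  ∏ a ∈ F, Γ.weight a.1 a.2

open Classical in
/-- The set of all in-forests of `Γ`, i.e. of all spanning subgraphs (given by their sets of arcs)
that are converging forests. -/
noncomputable def inForests (Γ : WeightedDigraph V) : Finset (Finset (V × V)) :=
  Γ.arcs.powerset.filter fun F => ArcSet.IsConvergingForest F

open Classical in
/-- The set of all in-forests of `Γ` with `k` arcs where `i` belongs to a tree converging
to `j`. -/
noncomputable def inForestsTo (Γ : WeightedDigraph V) (k : ℕ) (i j : V) :
    Finset (Finset (V × V)) :=
  Γ.inForests.filter fun F => F.card = k ∧ ArcSet.ConvergesTo F i j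

/-- The in-forest dimension: the minimum possible number of trees in an in-forest of `Γ`. -/
noncomputable def inForestDim (Γ : WeightedDigraph V) : ℕ :=
  sInf {m : ℕ | ∃ F ∈ Γ.inForests, ArcSet.numTrees F = m}

/-- The matrix `Q_k` of in-forests of `Γ` with `k` arcs: its `(i, j)` entry is the total weight of
the in-forests with `k` arcs where `i` belongs to a tree converging to `j`. -/
noncomputable def inForestMatrix (Γ : WeightedDigraph V) (k : ℕ) : Matrix V V ℝ :=
  Matrix.of fun i j => ∑ F ∈ Γ.inForestsTo k i j, Γ.subgraphWeight F

/-- The (row) Laplacian matrix of `Γ`. -/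
def laplacian (Γ : WeightedDigraph V) : Matrix V V ℝ :=
  Matrix.of fun i j => if i = j then ∑ m ∈ Finset.univ.erase i, Γ.weight i m else -Γ.weight i j

end WeightedDigraph

/-- The matrices produced by the Leverrier-Faddeev algorithm for `A`: `B₀ = I` and
`Bₖ₊₁ = A Bₖ - pₖ₊₁ I` with `pₖ₊₁ = tr (A Bₖ) / (k + 1)`. -/
noncomputable def faddeevMatrix {V : Type*} [Fintype V] [DecidableEq V] (A : Matrix V V ℝ) :
    ℕ → Matrix V V ℝ
  | 0 => 1
  | k + 1 => A * faddeevMatrix A k -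
      ((A * faddeevMatrix A k).trace / ((k : ℝ) + 1)) • (1 : Matrix V V ℝ)

/-! Write `s k` for the total weight of the in-forests with k arcs. The combinatorial heart is the
recursion Q_{k+1} = -L Q_k + s_{k+1} I (`inForestMatrix_succ`). Fix a vertex i and group all forests
by what remains after deleting the arc leaving i; within each group the contributions to the (i, j)
entry of the recursion cancel (`sum_convergesTo_balance`). A forest with k arcs has n - k roots, so
tr Q_k = (n - k) s_k. These two facts determine everything. Taking traces in the recursion expresses
s_{k+1} through tr(-L Q_k), which is Faddeev's rule. With A = -L, P = ∑ Q_k X^{n-k-1} and σ = ∑ s_k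
X^{n-k}, the recursion telescopes to (XI - A) P = σ I, while the traces give tr P = σ'. Since the
trace of adj(XI - A) is χ', it follows that σ χ' = χ σ', hence σ = χ and P is the adjugate. No
determinant is expanded over forests. -/

/-! ### Polynomials and the adjugate of the characteristic matrix. -/

open Polynomial in
theorem Polynomial.eq_of_mul_derivative_eq {p q : ℝ[X]} (hp : p.Monic) (hq : q.Monic)
    (hdeg : p.natDegree = q.natDegree) (h : derivative p * q = p * derivative q) : p = q := by
  by_contra hne
  have hd0 : p - q ≠ 0 := sub_ne_zero.mpr hne
  have hpq : p.degree = q.degree := by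
    rw [degree_eq_natDegree hp.ne_zero, degree_eq_natDegree hq.ne_zero, hdeg]
  have hlt : (p - q).natDegree < q.natDegree := by
    have h1 := degree_sub_lt_left hpq hp.ne_zero (by rw [hp.leadingCoeff, hq.leadingCoeff])
    rw [← hdeg]
    exact natDegree_lt_natDegree hd0 h1
  have h2 : derivative (p - q) * q = (p - q) * derivative q := by
    rw [derivative_sub]; linear_combination h
  -- Comparing top coefficients in `d' * q = d * q'` forces `deg d = deg q`, although `d` has
  -- smaller degree.
  set d := p - q with hd
  obtain ⟨n, hn⟩ : ∃ n, q.natDegree = n + 1 := ⟨q.natDegree - 1, by omega⟩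
  have h3 : (d * derivative q).coeff (d.natDegree + n) = d.leadingCoeff * (n + 1) := by
    rw [coeff_mul_add_eq_of_natDegree_le le_rfl
      ((natDegree_derivative_le q).trans (by omega)), coeff_derivative, ← hn,
      hq.coeff_natDegree, one_mul, leadingCoeff]
  have h4 : (derivative d * q).coeff (d.natDegree + n) = d.leadingCoeff * d.natDegree := by
    rcases Nat.eq_zero_or_pos d.natDegree with h0 | h0
    · rw [eq_C_of_natDegree_eq_zero h0]; simp
    · obtain ⟨m, hm⟩ : ∃ m, d.natDegree = m + 1 := ⟨d.natDegree - 1, by omega⟩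
      have : d.natDegree + n = m + (n + 1) := by omega
      rw [this, coeff_mul_add_eq_of_natDegree_le
        ((natDegree_derivative_le d).trans (by omega)) hn.le, coeff_derivative, ← hm, ← hn,
        ← leadingCoeff, ← leadingCoeff, hq.leadingCoeff, hm]
      simp
  rw [h2, h3] at h4
  have h5 := mul_left_cancel₀ (leadingCoeff_ne_zero.mpr hd0) h4
  have h6 : n + 1 = d.natDegree := by exact_mod_cast h5
  omega

namespace Matrix

open Polynomial

variable {V : Type*} [Fintype V] [DecidableEq V]

theorem derivative_det {R : Type*} [CommRing R] (M : Matrix V V R[X]) :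
    derivative M.det = ∑ i, (M.updateRow i fun j => derivative (M i j)).det := by
  simp_rw [← det_transpose M, ← det_transpose (updateRow _ _ _), det_apply, derivative_sum]
  rw [Finset.sum_comm]
  refine Finset.sum_congr rfl fun σ _ => ?_
  rw [← Finset.smul_sum, Units.smul_def, Units.smul_def, derivative_smul, derivative_prod_finset]
  congr 1
  refine Finset.sum_congr rfl fun i _ => ?_
  rw [← Finset.prod_erase_mul _ _ (Finset.mem_univ i)]
  congr 1
  · refine Finset.prod_congr rfl fun k hk => ?_
    simp [transpose_apply, updateRow_ne (Finset.ne_of_mem_erase hk)]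
  · simp [transpose_apply]

theorem derivative_charpoly {R : Type*} [CommRing R] (A : Matrix V V R) :
    derivative A.charpoly = A.charmatrix.adjugate.trace := by
  rw [charpoly, derivative_det, trace]
  refine Finset.sum_congr rfl fun i _ => ?_
  rw [diag_apply, adjugate_apply]
  congr 2
  ext1 j
  rcases eq_or_ne i j with rfl | h
  · simp [charmatrix_apply_eq]
  · simp [charmatrix_apply_ne _ _ _ h, h.symm]

/-- A matrix sequence that satisfies the Leverrier-Faddeev recursion with matching traces consists
of the coefficients of the adjugate of the characteristic matrix. -/
theorem adjugate_charmatrix_eq_sum (A : Matrix V V ℝ) (B : ℕ → Matrix V V ℝ) (s : ℕ → ℝ)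
    (hB0 : B 0 = 1) (hs0 : s 0 = 1) (hBn : B (Fintype.card V) = 0)
    (hrec : ∀ k, B (k + 1) = A * B k + s (k + 1) • (1 : Matrix V V ℝ))
    (htr : ∀ k ≤ Fintype.card V, (B k).trace = ((Fintype.card V - k : ℕ) : ℝ) * s k) :
    A.charmatrix.adjugate = ∑ k ∈ Finset.range (Fintype.card V),
      (X : ℝ[X]) ^ (Fintype.card V - k - 1) • (B k).map C := by
  set n := Fintype.card V with hn
  rcases isEmpty_or_nonempty V with hV | hV
  · exact Subsingleton.elim _ _
  set P := ∑ k ∈ Finset.range n, (X : ℝ[X]) ^ (n - k - 1) • (B k).map C with hP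
  set σ : ℝ[X] := ∑ k ∈ Finset.range (n + 1), C (s k) * X ^ (n - k) with hσ
  have hmul : A.charmatrix * P = σ • (1 : Matrix V V ℝ[X]) := by
    -- Replacing `A * B k` by `B (k + 1) - s (k + 1) • 1` leaves a scalar term and a difference that
    -- telescopes; the ends are `B 0 = 1` and `B n = 0`.
    have hterm : ∀ k ∈ Finset.range n, A.charmatrix * ((X : ℝ[X]) ^ (n - k - 1) • (B k).map C) =
        (C (s (k + 1)) * X ^ (n - (k + 1))) • (1 : Matrix V V ℝ[X]) +
        ((X : ℝ[X]) ^ (n - k) • (B k).map C - (X : ℝ[X]) ^ (n - (k + 1)) • (B (k + 1)).map C) := by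
      intro k hk
      have hk := Finset.mem_range.mp hk
      have e1 : n - k = n - (k + 1) + 1 := by omega
      have e2 : n - k - 1 = n - (k + 1) := by omega
      have hm : (B (k + 1)).map C = A.map C * (B k).map C +
          C (s (k + 1)) • (1 : Matrix V V ℝ[X]) := by
        rw [hrec k]
        ext1 i j
        by_cases h : i = j <;> simp [mul_apply, h]
      rw [hm, e2, e1, charmatrix, Matrix.mul_smul, sub_mul, RingHom.mapMatrix_apply, scalar_apply,
        ← smul_one_eq_diagonal, smul_mul, Matrix.one_mul, smul_sub, smul_smul, ← pow_succ,
        smul_add, smul_smul, mul_comm (C _)]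
      abel
    rw [hP, Finset.mul_sum, Finset.sum_congr rfl hterm, Finset.sum_add_distrib,
      Finset.sum_range_sub' (fun k => (X : ℝ[X]) ^ (n - k) • (B k).map C), hBn, hB0, hσ,
      Finset.sum_range_succ', hs0, add_smul, Finset.sum_smul]
    simp
  have htrP : P.trace = derivative σ := by
    rw [hP, trace_sum, hσ, derivative_sum, Finset.sum_range_succ]
    simp only [Nat.sub_self, pow_zero, mul_one, derivative_C, add_zero]
    refine Finset.sum_congr rfl fun k hk => ?_
    have hk := Finset.mem_range.mp hk
    rw [trace_smul, derivative_C_mul_X_pow, ← mul_comm ((n - k : ℕ) : ℝ), ← htr k hk.le,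
      smul_eq_mul, mul_comm]
    simp [trace, map_sum]
  have hσd : σ.natDegree ≤ n := natDegree_sum_le_of_forall_le _ _ fun k _ =>
    (natDegree_C_mul_X_pow_le _ _).trans (Nat.sub_le _ _)
  have hσn : σ.coeff n = 1 := by
    rw [hσ, finsetSum_coeff, Finset.sum_range_succ', Finset.sum_eq_zero]
    · simp [hs0]
    · intro k hk
      have hk := Finset.mem_range.mp hk
      rw [coeff_C_mul_X_pow, if_neg (by omega)]
  have hσm : σ.Monic := monic_of_natDegree_le_of_coeff_eq_one n hσd hσn
  have hσdeg : σ.natDegree = n :=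
    le_antisymm hσd (le_natDegree_of_ne_zero (by rw [hσn]; exact one_ne_zero))
  have hadj : σ • A.charmatrix.adjugate = A.charpoly • P := by
    have := congrArg (A.charmatrix.adjugate * ·) hmul
    simp only [← Matrix.mul_assoc, adjugate_mul, smul_mul, Matrix.one_mul, Matrix.mul_smul,
      Matrix.mul_one] at this
    exact this.symm
  -- The trace of `hadj` reads `σ * χ' = χ * σ'`, with `χ` the characteristic polynomial.
  have hσc : σ = A.charpoly := by
    refine eq_of_mul_derivative_eq hσm A.charpoly_monic (by rw [hσdeg, charpoly_natDegree_eq_dim])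
      ?_
    rw [derivative_charpoly, ← htrP, ← smul_eq_mul σ, ← trace_smul, hadj, trace_smul, smul_eq_mul,
      mul_comm]
  rw [← hσc] at hadj
  ext1 i j
  have := congrFun₂ hadj i j
  simpa [smul_apply, hσm.ne_zero] using! this

/-- The trace of the recursion is `(n - k - 1) s_{k+1} = tr (A B_k) + n s_{k+1}`, so `s_{k+1}` is
Faddeev's coefficient up to sign. -/
theorem eq_faddeevMatrix (A : Matrix V V ℝ) (B : ℕ → Matrix V V ℝ) (s : ℕ → ℝ)
    (hB0 : B 0 = 1) (hrec : ∀ k, B (k + 1) = A * B k + s (k + 1) • (1 : Matrix V V ℝ))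
    (htr : ∀ k, (B k).trace = (Fintype.card V - k : ℝ) * s k) (k : ℕ) :
    B k = faddeevMatrix A k := by
  induction k with
  | zero => exact hB0
  | succ k ih =>
    have h := congrArg trace (hrec k)
    rw [htr, trace_add, trace_smul, trace_one, smul_eq_mul] at h
    have h' : (A * B k).trace / ((k : ℝ) + 1) = -s (k + 1) := by
      rw [div_eq_iff (by positivity)]
      push_cast at h
      linear_combination -h
    rw [faddeevMatrix, ← ih, h', hrec]
    simp

end Matrix

/-! ### Converging forests described by directed reachability. -/

namespace ArcSet

variable {V : Type*} {F : Finset (V × V)}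

/-- Reachability along directed paths. -/
def Reach (F : Finset (V × V)) : V → V → Prop :=
  Relation.ReflTransGen fun a b => (a, b) ∈ F

def IsRoot (F : Finset (V × V)) (r : V) : Prop := ∀ b, (r, b) ∉ F

/-- Every vertex has outdegree at most one. -/
def IsFunctional (F : Finset (V × V)) : Prop := ∀ ⦃a b c⦄, (a, b) ∈ F → (a, c) ∈ F → b = c

theorem IsRoot.eq_of_reach {r s : V} (hr : IsRoot F r) (h : Reach F r s) : s = r := by
  rcases Relation.ReflTransGen.cases_head h with h | ⟨c, hc, -⟩
  · exact h.symm
  · exact absurd hc (hr c)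

theorem IsFunctional.reach_of_arc (hF : IsFunctional F) {u v r : V} (hr : IsRoot F r)
    (h : Reach F u r) (huv : (u, v) ∈ F) : Reach F v r := by
  rcases Relation.ReflTransGen.cases_head h with rfl | ⟨c, hc, hcr⟩
  · exact absurd huv (hr v)
  · rwa [hF huv hc]

theorem IsFunctional.root_unique (hF : IsFunctional F) {v r s : V} (hr : IsRoot F r)
    (hs : IsRoot F s) (hvr : Reach F v r) (hvs : Reach F v s) : r = s := by
  induction hvr using Relation.ReflTransGen.head_induction_on with
  | refl => exact (hr.eq_of_reach hvs).symm
  | head h _ ih => exact ih (hF.reach_of_arc hs hvs h)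

/-- Reaching a fixed root passes across an arc in both directions: backwards trivially, forwards
because the arc is the only way out of its tail. -/
theorem IsFunctional.reach_of_reachable (hF : IsFunctional F) {v r : V} (hr : IsRoot F r)
    (h : (underlying F).Reachable r v) : Reach F v r := by
  rw [SimpleGraph.reachable_iff_reflTransGen] at h
  induction h with
  | refl => exact Relation.ReflTransGen.refl
  | tail _ h ih =>
    obtain ⟨-, h | h⟩ := (SimpleGraph.fromRel_adj _ _ _).mp h
    · exact hF.reach_of_arc hr ih h
    · exact Relation.ReflTransGen.head h ih

theorem Reach.reachable {v r : V} (h : Reach F v r) : (underlying F).Reachable v r := by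
  induction h with
  | refl => exact SimpleGraph.Reachable.refl _
  | @tail b c _ h ih =>
    rcases eq_or_ne b c with rfl | hne
    · exact ih
    · exact ih.trans (SimpleGraph.Adj.reachable
        ((SimpleGraph.fromRel_adj _ _ _).mpr ⟨hne, Or.inl h⟩))

theorem Reach.mono {G : Finset (V × V)} (hFG : F ⊆ G) {u v : V} (h : Reach F u v) : Reach G u v :=
  Relation.ReflTransGen.mono (fun _ _ hab => hFG hab) _ _ h

variable [DecidableEq V]

theorem outdegree_eq_zero_iff {v : V} : outdegree F v = 0 ↔ IsRoot F v := by
  rw [outdegree, Finset.card_eq_zero, Finset.filter_eq_empty_iff]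
  constructor
  · intro h b hb
    exact h hb rfl
  · rintro h ⟨a, b⟩ hab rfl
    exact h b hab

theorem outdegree_le_one_iff {v : V} :
    outdegree F v ≤ 1 ↔ ∀ b c, (v, b) ∈ F → (v, c) ∈ F → b = c := by
  rw [outdegree, Finset.card_le_one]
  constructor
  · intro h b c hb hc
    simpa using h (v, b) (by simp [hb]) (v, c) (by simp [hc])
  · rintro h ⟨a, b⟩ hab ⟨a', c⟩ hac
    simp only [Finset.mem_filter] at hab hac
    obtain ⟨hab, rfl⟩ := hab
    obtain ⟨hac, rfl⟩ := hac
    rw [h b c hab hac]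

theorem isFunctional_iff : IsFunctional F ↔ ∀ v, outdegree F v ≤ 1 := by
  simp_rw [outdegree_le_one_iff]
  rfl

theorem IsConvergingForest.isFunctional (h : IsConvergingForest F) : IsFunctional F := by
  rw [isFunctional_iff]
  intro v
  obtain ⟨r, -, h0, h1⟩ := h ((underlying F).connectedComponentMk v)
  rcases eq_or_ne v r with rfl | hne
  · omega
  · exact (h1 v rfl hne).le

theorem convergesTo_iff (hF : IsFunctional F) {v r : V} :
    ConvergesTo F v r ↔ IsRoot F r ∧ Reach F v r := by
  rw [ConvergesTo, IsConvergingTree, outdegree_eq_zero_iff]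
  constructor
  · rintro ⟨h1, h2, -⟩
    exact ⟨h2, hF.reach_of_reachable h2 (SimpleGraph.ConnectedComponent.exact h1)⟩
  · rintro ⟨h1, h2⟩
    refine ⟨SimpleGraph.ConnectedComponent.sound h2.reachable.symm, h1, fun w hw hne => ?_⟩
    have hwr : Reach F w r := hF.reach_of_reachable h1
      (h2.reachable.symm.trans (SimpleGraph.ConnectedComponent.exact hw).symm)
    refine le_antisymm (isFunctional_iff.mp hF w) (Nat.one_le_iff_ne_zero.mpr fun h0 => hne ?_)
    exact ((outdegree_eq_zero_iff.mp h0).eq_of_reach hwr).symm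

theorem isConvergingForest_iff :
    IsConvergingForest F ↔ IsFunctional F ∧ ∀ v, ∃ r, IsRoot F r ∧ Reach F v r := by
  constructor
  · intro h
    refine ⟨h.isFunctional, fun v => ?_⟩
    obtain ⟨r, hr⟩ := h ((underlying F).connectedComponentMk v)
    exact ⟨r, (convergesTo_iff h.isFunctional).mp hr⟩
  · rintro ⟨hF, h⟩ C
    induction C using SimpleGraph.ConnectedComponent.ind with
    | h v =>
      obtain ⟨r, hr⟩ := h v
      exact ⟨r, (convergesTo_iff hF).mpr hr⟩

theorem IsConvergingForest.exists_convergesTo (h : IsConvergingForest F) (v : V) :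
    ∃ r, ConvergesTo F v r := h _

theorem IsConvergingForest.convergesTo_unique (h : IsConvergingForest F) {v r s : V}
    (hr : ConvergesTo F v r) (hs : ConvergesTo F v s) : r = s := by
  rw [convergesTo_iff h.isFunctional] at hr hs
  exact h.isFunctional.root_unique hr.1 hs.1 hr.2 hs.2

theorem IsConvergingForest.convergesTo_self_iff (h : IsConvergingForest F) {v : V} :
    ConvergesTo F v v ↔ IsRoot F v := by
  rw [convergesTo_iff h.isFunctional]
  exact and_iff_left Relation.ReflTransGen.refl

theorem IsConvergingForest.convergesTo_iff_eq_of_isRoot (h : IsConvergingForest F) {v j : V}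
    (hv : IsRoot F v) : ConvergesTo F v j ↔ v = j := by
  rw [convergesTo_iff h.isFunctional]
  constructor
  · rintro ⟨-, h⟩
    exact (hv.eq_of_reach h).symm
  · rintro rfl
    exact ⟨hv, Relation.ReflTransGen.refl⟩

theorem isConvergingForest_empty : IsConvergingForest (∅ : Finset (V × V)) := by
  rw [isConvergingForest_iff]
  exact ⟨fun a b c h => by simp at h, fun v => ⟨v, fun b => by simp, Relation.ReflTransGen.refl⟩⟩

/-! ### Adding and deleting the arc that leaves a vertex. -/

section Insert

variable {G : Finset (V × V)} {i m : V}

theorem isRoot_insert_iff {r : V} (hG : IsRoot G i) :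
    IsRoot (insert (i, m) G) r ↔ IsRoot G r ∧ r ≠ i := by
  constructor
  · intro h
    refine ⟨fun b hb => h b (Finset.mem_insert_of_mem hb), ?_⟩
    rintro rfl
    exact h m (Finset.mem_insert_self _ _)
  · rintro ⟨h, hne⟩ b hb
    rcases Finset.mem_insert.mp hb with hb | hb
    · exact hne (Prod.ext_iff.mp hb).1
    · exact h b hb

theorem IsFunctional.insert (hF : IsFunctional G) (hi : IsRoot G i) :
    IsFunctional (insert (i, m) G) := by
  intro a b c hb hc
  rw [Finset.mem_insert, Prod.mk.injEq] at hb hc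
  rcases hb with ⟨rfl, rfl⟩ | hb <;> rcases hc with ⟨hac, rfl⟩ | hc
  · rfl
  · exact absurd hc (hi _)
  · exact absurd (hac ▸ hb) (hi _)
  · exact hF hb hc

theorem IsConvergingForest.insert (hG : IsConvergingForest G) (hi : IsRoot G i)
    (hm : ¬ ConvergesTo G m i) : IsConvergingForest (insert (i, m) G) := by
  have hF := hG.isFunctional
  have hsub : G ⊆ Insert.insert (i, m) G := Finset.subset_insert _ _
  rw [isConvergingForest_iff]
  refine ⟨hF.insert hi, fun v => ?_⟩
  obtain ⟨r, hr⟩ := hG.exists_convergesTo v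
  rcases eq_or_ne r i with rfl | hne
  · obtain ⟨s, hs⟩ := hG.exists_convergesTo m
    have hsr : s ≠ r := by rintro rfl; exact hm hs
    rw [convergesTo_iff hF] at hr hs
    exact ⟨s, (isRoot_insert_iff hi).mpr ⟨hs.1, hsr⟩, (hr.2.mono hsub).trans
      (Relation.ReflTransGen.head (Finset.mem_insert_self _ _) (hs.2.mono hsub))⟩
  · rw [convergesTo_iff hF] at hr
    exact ⟨r, (isRoot_insert_iff hi).mpr ⟨hr.1, hne⟩, hr.2.mono hsub⟩

open Classical in
theorem IsConvergingForest.convergesTo_insert_iff (hG : IsConvergingForest G) (hi : IsRoot G i)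
    (hm : ¬ ConvergesTo G m i) {v j : V} :
    ConvergesTo (Insert.insert (i, m) G) v j ↔
      if ConvergesTo G v i then ConvergesTo G m j else ConvergesTo G v j := by
  have hF := hG.isFunctional
  have hsub : G ⊆ Insert.insert (i, m) G := Finset.subset_insert _ _
  have hG' := hG.insert hi hm
  have key : ∀ {u s}, ConvergesTo G u s → s ≠ i → ConvergesTo (Insert.insert (i, m) G) u s := by
    intro u s hs hne
    rw [convergesTo_iff hF] at hs
    rw [convergesTo_iff hG'.isFunctional]
    exact ⟨(isRoot_insert_iff hi).mpr ⟨hs.1, hne⟩, hs.2.mono hsub⟩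
  obtain ⟨s, hs⟩ := hG.exists_convergesTo m
  have hsi : s ≠ i := by rintro rfl; exact hm hs
  split_ifs with hv
  · have : ConvergesTo (Insert.insert (i, m) G) v s := by
      have h1 := key hs hsi
      rw [convergesTo_iff hG'.isFunctional] at h1 ⊢
      rw [convergesTo_iff hF] at hv
      exact ⟨h1.1, (hv.2.mono hsub).trans
        (Relation.ReflTransGen.head (Finset.mem_insert_self _ _) h1.2)⟩
    constructor
    · intro h; rwa [hG'.convergesTo_unique h this]
    · intro h; rwa [hG.convergesTo_unique h hs]
  · obtain ⟨r, hr⟩ := hG.exists_convergesTo v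
    have hri : r ≠ i := by rintro rfl; exact hv hr
    have := key hr hri
    constructor
    · intro h; rwa [hG'.convergesTo_unique h this]
    · intro h; rwa [hG.convergesTo_unique h hr]

theorem IsFunctional.isRoot_erase (hF : IsFunctional F) (him : (i, m) ∈ F) :
    IsRoot (F.erase (i, m)) i := by
  intro b hb
  rw [Finset.mem_erase] at hb
  exact hb.1 (by rw [hF him hb.2])

theorem IsConvergingForest.erase (hF : IsConvergingForest F) (him : (i, m) ∈ F) :
    IsConvergingForest (F.erase (i, m)) ∧ ¬ ConvergesTo (F.erase (i, m)) m i := by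
  have hfun := hF.isFunctional
  have hi := hfun.isRoot_erase him
  have hsub : F.erase (i, m) ⊆ F := Finset.erase_subset _ _
  have hfun' : IsFunctional (F.erase (i, m)) := fun a b c hb hc => hfun (hsub hb) (hsub hc)
  -- A path to `r` either avoids the deleted arc or can be cut at a visit to `i`.
  have key : ∀ v r, IsRoot F r → Reach F v r →
      Reach (F.erase (i, m)) v r ∨ Reach (F.erase (i, m)) v i := by
    intro v r hr h
    induction h using Relation.ReflTransGen.head_induction_on with
    | refl => exact Or.inl Relation.ReflTransGen.refl
    | @head a b hab _ ih =>
      rcases eq_or_ne a i with rfl | hne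
      · exact Or.inr Relation.ReflTransGen.refl
      · have : (a, b) ∈ F.erase (i, m) :=
          Finset.mem_erase.mpr ⟨fun h => hne (Prod.ext_iff.mp h).1, hab⟩
        exact ih.imp (Relation.ReflTransGen.head this) (Relation.ReflTransGen.head this)
  have hfor : IsConvergingForest (F.erase (i, m)) := by
    rw [isConvergingForest_iff]
    refine ⟨hfun', fun v => ?_⟩
    obtain ⟨r, hr⟩ := hF.exists_convergesTo v
    rw [convergesTo_iff hfun] at hr
    rcases key v r hr.1 hr.2 with h | h
    · exact ⟨r, fun b hb => hr.1 b (hsub hb), h⟩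
    · exact ⟨i, hi, h⟩
  refine ⟨hfor, fun hmi => ?_⟩
  rw [convergesTo_iff hfun'] at hmi
  obtain ⟨r, hr⟩ := hF.exists_convergesTo i
  rw [convergesTo_iff hfun] at hr
  -- every vertex reachable from `i` reaches `i`, so the root of `i` would be `i` itself
  have hcyc : ∀ v, Reach F i v → Reach F v i := by
    intro v hv
    induction hv with
    | refl => exact Relation.ReflTransGen.refl
    | @tail b c _ hbc ih =>
      rcases Relation.ReflTransGen.cases_head ih with rfl | ⟨d, hd, hdi⟩
      · rw [hfun hbc him]; exact hmi.2.mono hsub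
      · rwa [hfun hbc hd]
  have := hr.1.eq_of_reach (hcyc r hr.2)
  exact hr.1 m (this ▸ him)

end Insert

-- A forest in which `i` is not a root arises from exactly one pair `(G, m)`: delete the unique arc
-- leaving `i`. The condition on `m` rules out a cycle through `i`.
open Classical in
theorem sum_convergingForests [Fintype V] {M : Type*} [AddCommMonoid M] (i : V)
    (φ : Finset (V × V) → M) :
    ∑ F with IsConvergingForest F, φ F =
      ∑ G with IsConvergingForest G ∧ IsRoot G i,
        (φ G + ∑ m with ¬ ConvergesTo G m i, φ (insert (i, m) G)) := by
  rw [Finset.sum_add_distrib, ← Finset.sum_filter_add_sum_filter_not _ (fun F => IsRoot F i),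
    Finset.filter_filter, Finset.filter_filter, Finset.sum_sigma']
  congr 1
  symm
  refine Finset.sum_bij (fun x _ => insert (i, x.2) x.1) ?_ ?_ ?_ ?_
  · rintro ⟨G, m⟩ h
    simp only [Finset.mem_sigma, Finset.mem_filter, Finset.mem_univ, true_and] at h ⊢
    exact ⟨h.1.1.insert h.1.2 h.2, fun hr => hr m (Finset.mem_insert_self _ _)⟩
  · rintro ⟨G, m⟩ h ⟨G', m'⟩ h' heq
    simp only [Finset.mem_sigma, Finset.mem_filter, Finset.mem_univ, true_and] at h h' heq
    have hmem : (i, m) ∈ insert (i, m') G' := heq ▸ Finset.mem_insert_self _ _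
    have hm : m = m' := by
      rcases Finset.mem_insert.mp hmem with h1 | h1
      · exact (Prod.ext_iff.mp h1).2
      · exact absurd h1 (h'.1.2 _)
    subst hm
    have := congrArg (fun F => F.erase (i, m)) heq
    simp only [Finset.erase_insert (h.1.2 m), Finset.erase_insert (h'.1.2 m)] at this
    rw [this]
  · intro F hF
    simp only [Finset.mem_filter, Finset.mem_univ, true_and] at hF
    obtain ⟨hF, hr⟩ := hF
    rw [IsRoot] at hr
    push Not at hr
    obtain ⟨m, hm⟩ := hr
    obtain ⟨h1, h2⟩ := hF.erase hm
    refine ⟨⟨F.erase (i, m), m⟩, ?_, Finset.insert_erase hm⟩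
    simp only [Finset.mem_sigma, Finset.mem_filter, Finset.mem_univ, true_and]
    exact ⟨⟨h1, hF.isFunctional.isRoot_erase hm⟩, h2⟩
  · intros; rfl

open Classical in
theorem IsConvergingForest.card_roots_add_card [Fintype V] (hF : IsConvergingForest F) :
    (Finset.univ.filter (IsRoot F)).card + F.card = Fintype.card V := by
  have h1 : F.card = ∑ v, outdegree F v := by
    rw [Finset.card_eq_sum_card_fiberwise (f := Prod.fst) (t := Finset.univ) (by simp)]
    rfl
  rw [h1, Finset.card_filter, ← Finset.sum_add_distrib, Fintype.card_eq_sum_ones]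
  refine Finset.sum_congr rfl fun v _ => ?_
  have h2 := isFunctional_iff.mp hF.isFunctional v
  have h3 := outdegree_eq_zero_iff (F := F) (v := v)
  split_ifs with h
  · rw [h3.mpr h]
  · have := mt h3.mp h
    omega

open Classical in
theorem IsConvergingForest.numTrees_eq [Fintype V] (hF : IsConvergingForest F) :
    numTrees F = (Finset.univ.filter (IsRoot F)).card := by
  rw [numTrees, ← Fintype.card_subtype, ← Nat.card_eq_fintype_card]
  refine (Nat.card_congr (Equiv.ofBijective
    (fun r : {r // IsRoot F r} => (underlying F).connectedComponentMk r.1) ⟨?_, ?_⟩)).symm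
  · rintro ⟨r, hr⟩ ⟨s, hs⟩ h
    have := hF.isFunctional.reach_of_reachable hs (SimpleGraph.ConnectedComponent.exact h).symm
    exact Subtype.ext (hr.eq_of_reach this).symm
  · intro C
    obtain ⟨r, h1, h2, -⟩ := hF C
    exact ⟨⟨r, outdegree_eq_zero_iff.mp h2⟩, h1⟩

theorem IsConvergingForest.numTrees_add_card [Fintype V] (hF : IsConvergingForest F) :
    numTrees F + F.card = Fintype.card V := by
  classical
  rw [hF.numTrees_eq, hF.card_roots_add_card]

end ArcSet

/-! ### The forest matrices and their recursion. -/

namespace WeightedDigraph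

open ArcSet

variable {V : Type*} (Γ : WeightedDigraph V)

theorem subgraphWeight_insert [DecidableEq V] {G : Finset (V × V)} {i m : V} (hi : IsRoot G i) :
    Γ.subgraphWeight (insert (i, m) G) = Γ.weight i m * Γ.subgraphWeight G :=
  Finset.prod_insert (hi m)

variable [Fintype V]

theorem subgraphWeight_eq_zero {F : Finset (V × V)} (h : ¬ F ⊆ Γ.arcs) :
    Γ.subgraphWeight F = 0 := by
  obtain ⟨a, ha, hna⟩ := Finset.not_subset.mp h
  refine Finset.prod_eq_zero ha (le_antisymm (not_lt.mp fun hlt => hna ?_) (Γ.weight_nonneg _ _))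
  simp [arcs, hlt]

variable [DecidableEq V]

-- Forests using a non-arc of `Γ` have weight zero, so the sum may run over all converging forests
-- on `V`, where arcs can be inserted freely.
open Classical in
theorem inForestMatrix_apply (k : ℕ) (i j : V) :
    Γ.inForestMatrix k i j = ∑ F with IsConvergingForest F,
      Γ.subgraphWeight F * ((if F.card = k then 1 else 0) * if ConvergesTo F i j then 1 else 0) := by
  rw [inForestMatrix, Matrix.of_apply]
  refine Finset.sum_subset_zero_on_sdiff ?_ ?_ ?_
  · intro F hF
    simp only [inForestsTo, inForests, Finset.mem_filter] at hF
    simp [hF]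
  · intro F hF
    simp only [inForestsTo, inForests, Finset.mem_filter, Finset.mem_sdiff, Finset.mem_powerset,
      Finset.mem_univ, true_and] at hF
    by_cases hsub : F ⊆ Γ.arcs
    · by_cases h1 : F.card = k <;> by_cases h2 : ConvergesTo F i j <;> simp_all
    · rw [Γ.subgraphWeight_eq_zero hsub, zero_mul]
  · intro F hF
    simp only [inForestsTo, Finset.mem_filter] at hF
    simp [hF]

open Classical in
/-- The total weight of the in-forests with `k` arcs. -/
noncomputable def inForestWeight (k : ℕ) : ℝ :=
  ∑ F : Finset (V × V) with IsConvergingForest F,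
    Γ.subgraphWeight F * if F.card = k then 1 else 0

theorem trace_inForestMatrix (k : ℕ) :
    (Γ.inForestMatrix k).trace = (Fintype.card V - k : ℝ) * Γ.inForestWeight k := by
  classical
  simp_rw [Matrix.trace, Matrix.diag_apply, inForestMatrix_apply, inForestWeight]
  rw [Finset.sum_comm, Finset.mul_sum]
  refine Finset.sum_congr rfl fun F hF => ?_
  have hF : IsConvergingForest F := by simpa using hF
  simp_rw [← mul_assoc, hF.convergesTo_self_iff]
  rw [← Finset.mul_sum, Finset.sum_boole, ← hF.card_roots_add_card]
  split_ifs with h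
  · rw [h]; push_cast; ring
  · simp

theorem inForestMatrix_zero : Γ.inForestMatrix 0 = 1 := by
  classical
  ext i j
  have he := isConvergingForest_empty (V := V)
  rw [inForestMatrix_apply, Finset.sum_eq_single ∅]
  · simp [he.convergesTo_iff_eq_of_isRoot (v := i) (j := j) (by simp [IsRoot]), subgraphWeight,
      Matrix.one_apply]
  · intro F _ hF
    simp [hF]
  · simp [he]

theorem inForestWeight_zero : Γ.inForestWeight 0 = 1 := by
  classical
  rw [inForestWeight, Finset.sum_eq_single ∅]
  · simp [subgraphWeight]
  · intro F _ hF
    simp [hF]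
  · simp [isConvergingForest_empty]

theorem inForestMatrix_eq_zero {k : ℕ} (hk : Fintype.card V < k + Γ.inForestDim) :
    Γ.inForestMatrix k = 0 := by
  classical
  ext i j
  rw [inForestMatrix, Matrix.of_apply, Matrix.zero_apply]
  refine Finset.sum_eq_zero fun F hF => ?_
  simp only [inForestsTo, Finset.mem_filter] at hF
  obtain ⟨hF, hc, -⟩ := hF
  have h1 : Γ.inForestDim ≤ numTrees F := Nat.sInf_le ⟨F, hF, rfl⟩
  simp only [inForests, Finset.mem_filter] at hF
  have := hF.2.numTrees_add_card
  omega

theorem inForestDim_pos [Nonempty V] : 0 < Γ.inForestDim := by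
  classical
  have hne : {m : ℕ | ∃ F ∈ Γ.inForests, numTrees F = m}.Nonempty :=
    ⟨_, ∅, by simp [inForests, isConvergingForest_empty], rfl⟩
  obtain ⟨F, -, h⟩ := Nat.sInf_mem hne
  rw [inForestDim, ← h, numTrees]
  have : Nonempty (underlying F).ConnectedComponent :=
    ⟨(underlying F).connectedComponentMk (Classical.arbitrary V)⟩
  exact Nat.card_pos

theorem laplacian_mul_apply (B : Matrix V V ℝ) (i j : V) :
    (Γ.laplacian * B) i j = ∑ m, Γ.weight i m * (B i j - B m j) := by
  rw [Matrix.mul_apply]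
  simp_rw [mul_sub, Finset.sum_sub_distrib]
  rw [← Finset.sum_mul, ← Finset.add_sum_erase _ _ (Finset.mem_univ i),
    ← Finset.add_sum_erase _ (fun m => Γ.weight i m) (Finset.mem_univ i),
    ← Finset.add_sum_erase _ (fun m => Γ.weight i m * B m j) (Finset.mem_univ i), Γ.weight_self,
    zero_add, zero_mul, zero_add, sub_eq_add_neg, ← Finset.sum_neg_distrib]
  congr 1
  · simp [laplacian]
  · refine Finset.sum_congr rfl fun m hm => ?_
    simp [laplacian, (Finset.ne_of_mem_erase hm).symm]

-- This is the (i, j) entry of the recursion, summed forest by forest. In the group of `G`, where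
-- `i` is a root, a new arc from `i` must end in the set `N` of vertices outside the tree of `i`.
-- The forests with k + 1 arcs obtained from `G` cancel the Laplacian term of `G` itself; the
-- Laplacian terms of the enlarged forests cancel in pairs.
open Classical in
theorem sum_convergesTo_balance (k : ℕ) (i j : V) :
    ∑ F with IsConvergingForest F, Γ.subgraphWeight F *
      ((if F.card = k + 1 then 1 else 0) *
          ((if ConvergesTo F i j then 1 else 0) - if i = j then 1 else 0) +
        (if F.card = k then 1 else 0) * ∑ m, Γ.weight i m *
          ((if ConvergesTo F i j then 1 else 0) - if ConvergesTo F m j then 1 else 0)) = 0 := by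
  rw [sum_convergingForests i]
  refine Finset.sum_eq_zero fun G hG => ?_
  obtain ⟨hG, hi⟩ : IsConvergingForest G ∧ IsRoot G i := by simpa using hG
  have hii : ConvergesTo G i i := hG.convergesTo_self_iff.mpr hi
  set δ : ℝ := if i = j then 1 else 0 with hδ
  set c : V → ℝ := fun v => if ConvergesTo G v j then 1 else 0 with hc
  set N : Finset V := Finset.univ.filter fun m => ¬ ConvergesTo G m i with hN
  have hT : ∀ m, m ∉ N → c m = δ := by
    intro m hm
    have hm : ConvergesTo G m i := by simpa [hN] using hm
    have : ConvergesTo G m j ↔ i = j :=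
      ⟨fun h => hG.convergesTo_unique hm h, fun h => h ▸ hm⟩
    simp only [hc, hδ, this]
  have hci : c i = δ := hT i (by simpa [hN] using hii)
  have hroot : ∑ m, Γ.weight i m * (c i - c m) = ∑ m ∈ N, Γ.weight i m * (δ - c m) := by
    rw [hci]
    symm
    refine Finset.sum_subset (Finset.subset_univ _) fun m _ hm => ?_
    rw [hT m hm, sub_self, mul_zero]
  -- The new arc redirects the whole tree of `i` to the root of `m'` and leaves other vertices
  -- alone.
  have hins : ∀ m' ∈ N, ∀ v, (if ConvergesTo (insert (i, m') G) v j then (1 : ℝ) else 0) =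
      if v ∈ N then c v else c m' := by
    intro m' hm' v
    have hm' : ¬ ConvergesTo G m' i := by simpa [hN] using hm'
    simp only [hG.convergesTo_insert_iff hi hm', hN, Finset.mem_filter, Finset.mem_univ, true_and,
      hc]
    by_cases h : ConvergesTo G v i <;> simp [h]
  have hi' : i ∉ N := by simpa [hN] using hii
  have hsum : ∀ m' ∈ N, ∑ m, Γ.weight i m * (c m' - if m ∈ N then c m else c m') =
      ∑ m ∈ N, Γ.weight i m * (c m' - c m) := by
    intro m' _
    rw [← Finset.sum_subset (Finset.subset_univ N)]
    · refine Finset.sum_congr rfl fun m hm => by rw [if_pos hm]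
    · intro m _ hm
      rw [if_neg hm, sub_self, mul_zero]
  have hterm : ∀ m' ∈ N, Γ.subgraphWeight (insert (i, m') G) *
      ((if (insert (i, m') G).card = k + 1 then 1 else 0) *
          ((if ConvergesTo (insert (i, m') G) i j then 1 else 0) - δ) +
        (if (insert (i, m') G).card = k then 1 else 0) * ∑ m, Γ.weight i m *
          ((if ConvergesTo (insert (i, m') G) i j then 1 else 0) -
            if ConvergesTo (insert (i, m') G) m j then 1 else 0)) =
      Γ.subgraphWeight G * (if G.card = k then 1 else 0) * (Γ.weight i m' * (c m' - δ)) +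
      Γ.subgraphWeight G * (if G.card + 1 = k then 1 else 0) *
        ∑ m ∈ N, Γ.weight i m' * (Γ.weight i m * (c m' - c m)) := by
    intro m' hm'
    simp_rw [hins m' hm']
    rw [if_neg hi', hsum m' hm', Γ.subgraphWeight_insert hi, Finset.card_insert_of_notMem (hi m'),
      ← Finset.mul_sum]
    simp only [add_left_inj]
    ring
  -- The summand is antisymmetric under exchange of `m` and `m'`.
  have hanti : ∑ m' ∈ N, ∑ m ∈ N, Γ.weight i m' * (Γ.weight i m * (c m' - c m)) = 0 := by
    have h : ∑ m' ∈ N, ∑ m ∈ N, Γ.weight i m' * (Γ.weight i m * (c m' - c m)) =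
        -∑ m' ∈ N, ∑ m ∈ N, Γ.weight i m' * (Γ.weight i m * (c m' - c m)) := by
      conv_lhs => rw [Finset.sum_comm]
      rw [← Finset.sum_neg_distrib]
      refine Finset.sum_congr rfl fun m' _ => ?_
      rw [← Finset.sum_neg_distrib]
      exact Finset.sum_congr rfl fun m _ => by ring
    linarith
  rw [Finset.sum_congr rfl hterm, Finset.sum_add_distrib, ← Finset.mul_sum, ← Finset.mul_sum,
    hanti, mul_zero, add_zero]
  have hneg : ∑ m ∈ N, Γ.weight i m * (δ - c m) = -∑ m ∈ N, Γ.weight i m * (c m - δ) := by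
    rw [← Finset.sum_neg_distrib]
    exact Finset.sum_congr rfl fun m _ => by ring
  change Γ.subgraphWeight G * (_ * (c i - δ) + _ * ∑ m, Γ.weight i m * (c i - c m)) + _ = 0
  rw [hroot, hci, hneg]
  ring

theorem inForestMatrix_succ (k : ℕ) :
    Γ.inForestMatrix (k + 1) = -Γ.laplacian * Γ.inForestMatrix k +
      Γ.inForestWeight (k + 1) • (1 : Matrix V V ℝ) := by
  classical
  ext i j
  have h := Γ.sum_convergesTo_balance k i j
  have h1 : ∑ m, Γ.weight i m * (Γ.inForestMatrix k i j - Γ.inForestMatrix k m j) =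
      ∑ F with IsConvergingForest F, Γ.subgraphWeight F *
        ((if F.card = k then 1 else 0) * ∑ m, Γ.weight i m *
          ((if ConvergesTo F i j then 1 else 0) - if ConvergesTo F m j then 1 else 0)) := by
    simp_rw [inForestMatrix_apply, ← Finset.sum_sub_distrib, Finset.mul_sum]
    rw [Finset.sum_comm]
    refine Finset.sum_congr rfl fun F _ => Finset.sum_congr rfl fun m _ => ?_
    ring
  simp_rw [mul_add, mul_sub (ite (Finset.card _ = k + 1) _ _)] at h
  simp_rw [mul_sub (Γ.subgraphWeight _) (_ * ite (ConvergesTo _ i j) _ _),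
    ← mul_assoc (Γ.subgraphWeight _) _ (ite (i = j) _ _)] at h
  rw [Finset.sum_add_distrib, Finset.sum_sub_distrib, ← Finset.sum_mul, ← h1,
    ← inForestMatrix_apply, ← inForestWeight] at h
  rw [neg_mul, Matrix.add_apply, Matrix.neg_apply, laplacian_mul_apply, Matrix.smul_apply,
    Matrix.one_apply, smul_eq_mul]
  linarith

end WeightedDigraph

/-! ### Assembly of the four claims. -/

theorem proposition3 {V : Type*} [Fintype V] [DecidableEq V] (Γ : WeightedDigraph V) :
    (∀ x : ℝ, (x • (1 : Matrix V V ℝ) + Γ.laplacian).adjugate =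
      ∑ k ∈ Finset.range (Fintype.card V - Γ.inForestDim + 1),
        x ^ (Fintype.card V - k - 1) • Γ.inForestMatrix k) ∧
    ((-Γ.laplacian).charmatrix.adjugate =
      ∑ k ∈ Finset.range (Fintype.card V - Γ.inForestDim + 1),
        (Polynomial.X : Polynomial ℝ) ^ (Fintype.card V - k - 1) •
          (Γ.inForestMatrix k).map Polynomial.C) ∧
    (∀ k < Fintype.card V,
      (-Γ.laplacian).charmatrix.adjugate.map (fun p => p.coeff (Fintype.card V - k - 1)) =
        Γ.inForestMatrix k) ∧
    (∀ k : ℕ, Γ.inForestMatrix k = faddeevMatrix (-Γ.laplacian) k) := by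
  have hfad := Matrix.eq_faddeevMatrix (-Γ.laplacian) Γ.inForestMatrix Γ.inForestWeight
    Γ.inForestMatrix_zero Γ.inForestMatrix_succ Γ.trace_inForestMatrix
  rcases isEmpty_or_nonempty V with hV | hV
  · exact ⟨fun x => Subsingleton.elim _ _, Subsingleton.elim _ _, fun k _ => Subsingleton.elim _ _,
      hfad⟩
  -- Positivity of the forest dimension gives both `Q_n = 0` and the inclusion of the summation
  -- range in `range n`.
  have hd := Γ.inForestDim_pos
  have hn : 0 < Fintype.card V := Fintype.card_pos
  have hrange : Finset.range (Fintype.card V - Γ.inForestDim + 1) ⊆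
      Finset.range (Fintype.card V) := Finset.range_subset_range.mpr (by omega)
  have hadj := Matrix.adjugate_charmatrix_eq_sum (-Γ.laplacian) Γ.inForestMatrix Γ.inForestWeight
    Γ.inForestMatrix_zero Γ.inForestWeight_zero (Γ.inForestMatrix_eq_zero (by omega))
    Γ.inForestMatrix_succ fun k hk => by rw [Γ.trace_inForestMatrix, Nat.cast_sub hk]
  have hpoly : (-Γ.laplacian).charmatrix.adjugate =
      ∑ k ∈ Finset.range (Fintype.card V - Γ.inForestDim + 1),
        (Polynomial.X : Polynomial ℝ) ^ (Fintype.card V - k - 1) •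
          (Γ.inForestMatrix k).map Polynomial.C := by
    rw [hadj]
    symm
    refine Finset.sum_subset hrange fun k _ hk => ?_
    rw [Γ.inForestMatrix_eq_zero (by rw [Finset.mem_range] at hk; omega)]
    ext1 i j
    simp
  refine ⟨fun x => ?_, hpoly, fun k hk => ?_, hfad⟩
  · have h := (Polynomial.evalRingHom x).map_adjugate (-Γ.laplacian).charmatrix
    have hx : (Polynomial.evalRingHom x).mapMatrix (-Γ.laplacian).charmatrix =
        x • (1 : Matrix V V ℝ) + Γ.laplacian := by
      ext i j
      rcases eq_or_ne i j with rfl | hij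
      · simp [Matrix.charmatrix_apply_eq]
      · simp [hij]
    rw [← hx, ← h, hpoly, map_sum]
    refine Finset.sum_congr rfl fun k _ => ?_
    ext i j
    simpa using mul_comm _ _
  · rw [hadj]
    ext i j
    rw [Matrix.map_apply, Matrix.sum_apply, Polynomial.finsetSum_coeff,
      Finset.sum_eq_single_of_mem k (Finset.mem_range.mpr hk)]
    · simp
    · intro l hl hlk
      rw [Finset.mem_range] at hl
      simp [Polynomial.coeff_X_pow]
      omega
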